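/- Let $\Gamma$ be a discrete subgroup of $\mathrm{SL}(2,\mathbb{R})$ acting cocompactly on the hyperbolic plane $\mathbb{H}^2$, such that no element of $\Gamma$ other than $\pm 1$ has a fixed point in $\mathbb{H}^2$. Let $S=\Gamma\backslash\mathbb{H}^2$ be the resulting closed connected oriented hyperbolic surface (every such surface is of this form), let $T^1(S)=\Gamma\backslash T^1(\mathbb{H}^2)$ be its unit tangent bundle, and let $\psi$ be the geodesic flow on $T^1(S)$. A closed geodesic is a periodic orbit $c\subset T^1(S)$ of $\psi$. Its self-intersections are the unordered pairs of distinct points of $c$ with the same projection to $S$; equivalently, the pairs of times $t<t'$ in one period $[0,T)$ at which the geodesic passes through the same point of $S$. For an integer $p\ge 0$, let $\mathcal{F}_p(S)\subset T^1(S)$ be the closure of the union of all closed geodesics with at most $p$ self-intersections. If $c\subset T^1(S)$ is a closed geodesic with more than $p$ self-intersections, then $c\subset T^1(S)\setminus\mathcal{F}_p(S)$. -/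

import Mathlib

open scoped UpperHalfPlane MatrixGroups ComplexConjugate

noncomputable section

namespace HypSurface

/-! ## The unit tangent bundle of the hyperbolic plane -/

/-- The unit tangent bundle of the hyperbolic plane. As `ℍ` is open in `ℂ`, its tangent bundle is
`ℍ × ℂ`; the hyperbolic norm of a tangent vector `v` at `z` is `‖v‖ / Im z`. -/
abbrev T1H : Type := {x : ℍ × ℂ // ‖x.2‖ = x.1.im}

/-- The footpoint of a unit tangent vector. -/
def T1H.pt (x : T1H) : ℍ := x.1.1

/-- The vector part of a unit tangent vector. -/
def T1H.vec (x : T1H) : ℂ := x.1.2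

theorem T1H.norm_vec (x : T1H) : ‖x.vec‖ = x.pt.im := x.2

theorem T1H.ext' {x y : T1H} (h₁ : (x.pt : ℂ) = y.pt) (h₂ : x.vec = y.vec) : x = y :=
  Subtype.ext (Prod.ext (UpperHalfPlane.ext h₁) h₂)

/-- The automorphy factor `c z + d`; the derivative of `w ↦ g • w` at `z` is `(c z + d)⁻²`. -/
def cocyc (g : SL(2, ℝ)) (z : ℍ) : ℂ := (g 1 0 : ℂ) * z + (g 1 1 : ℂ)

theorem cocyc_ne_zero (g : SL(2, ℝ)) (z : ℍ) : cocyc g z ≠ 0 :=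
  UpperHalfPlane.denom_ne_zero (g : GL (Fin 2) ℝ) z

theorem coe_smul_eq (g : SL(2, ℝ)) (z : ℍ) :
    ((g • z : ℍ) : ℂ) = ((g 0 0 : ℂ) * z + (g 0 1 : ℂ)) / cocyc g z :=
  UpperHalfPlane.coe_specialLinearGroup_apply g z

theorem det_eq (g : SL(2, ℝ)) : (g 0 0 : ℂ) * g 1 1 - (g 0 1 : ℂ) * g 1 0 = 1 := by
  have h := g.det_coe
  rw [Matrix.det_fin_two] at h
  exact_mod_cast h

theorem im_smul_eq (g : SL(2, ℝ)) (z : ℍ) : (g • z : ℍ).im = z.im / ‖cocyc g z‖ ^ 2 := by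
  have h := UpperHalfPlane.im_smul_eq_div_normSq (g : GL (Fin 2) ℝ) z
  rw [← Complex.normSq_eq_norm_sq]
  refine h.trans ?_
  rw [show ((g : GL (Fin 2) ℝ).det.val : ℝ) = 1 from g.det_coe, abs_one, one_mul]
  rfl

theorem cocyc_mul (g h : SL(2, ℝ)) (z : ℍ) :
    cocyc (g * h) z = cocyc g (h • z) * cocyc h z := by
  have hne := cocyc_ne_zero h z
  rw [cocyc, cocyc, coe_smul_eq]
  field_simp
  simp only [Matrix.SpecialLinearGroup.coe_mul, Matrix.mul_apply, Fin.sum_univ_two, cocyc]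
  push_cast
  ring

/-- The action of `SL(2, ℝ)` on the unit tangent bundle by differentials of Möbius maps. -/
instance : MulAction SL(2, ℝ) T1H where
  smul g x := ⟨(g • x.pt, x.vec / cocyc g x.pt ^ 2), by
    simp only [norm_div, norm_pow, x.norm_vec, im_smul_eq]⟩
  one_smul x := by
    refine T1H.ext' (congrArg _ (one_smul SL(2, ℝ) x.pt)) ?_
    change x.vec / cocyc 1 x.pt ^ 2 = x.vec
    simp [cocyc]
  mul_smul g h x := by
    refine T1H.ext' (congrArg _ (mul_smul g h x.pt)) ?_
    change x.vec / cocyc (g * h) x.pt ^ 2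
      = x.vec / cocyc h x.pt ^ 2 / cocyc g (h • x.pt) ^ 2
    rw [cocyc_mul, mul_pow, div_div, mul_comm]

theorem smul_pt (g : SL(2, ℝ)) (x : T1H) : (g • x).pt = g • x.pt := rfl

theorem smul_vec (g : SL(2, ℝ)) (x : T1H) : (g • x).vec = x.vec / cocyc g x.pt ^ 2 := rfl

/-! ## The geodesic flow -/

/-- The direction of a unit tangent vector, as a complex number of modulus one. -/
def T1H.dir (x : T1H) : ℂ := x.vec / x.pt.im

theorem T1H.norm_dir (x : T1H) : ‖x.dir‖ = 1 := by
  rw [T1H.dir, norm_div, x.norm_vec, Complex.norm_real, Real.norm_of_nonneg x.pt.im_pos.le]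
  exact div_self x.pt.im_ne_zero

theorem T1H.dir_mul_conj (x : T1H) : x.dir * conj x.dir = 1 := by
  rw [Complex.mul_conj, Complex.normSq_eq_norm_sq, x.norm_dir]; simp

theorem T1H.vec_eq (x : T1H) : x.vec = x.dir * x.pt.im := by
  have : (x.pt.im : ℂ) ≠ 0 := by exact_mod_cast x.pt.im_ne_zero
  rw [T1H.dir, div_mul_cancel₀ _ this]

/-- Numerator of the footpoint at time `t` of the geodesic through `x`. -/
def flowNum (t : ℝ) (x : T1H) : ℂ :=
  x.pt * Real.cosh (t / 2) + Complex.I * x.dir * conj (x.pt : ℂ) * Real.sinh (t / 2)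

/-- Denominator of the footpoint at time `t` of the geodesic through `x`. -/
def flowDen (t : ℝ) (x : T1H) : ℂ :=
  Real.cosh (t / 2) + Complex.I * x.dir * Real.sinh (t / 2)

theorem flowDen_ne_zero (t : ℝ) (x : T1H) : flowDen t x ≠ 0 := by
  intro h
  have h1 : (Real.cosh (t / 2) : ℂ) = -(Complex.I * x.dir * Real.sinh (t / 2)) :=
    eq_neg_of_add_eq_zero_left h
  have h2 := congrArg (fun w : ℂ => ‖w‖ ^ 2) h1
  simp only [norm_neg, norm_mul, Complex.norm_I, x.norm_dir, Complex.norm_real, one_mul,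
    Real.norm_eq_abs, sq_abs] at h2
  have := Real.cosh_sq_sub_sinh_sq (t / 2)
  linarith

theorem im_flow (t : ℝ) (x : T1H) :
    (flowNum t x / flowDen t x).im = x.pt.im / ‖flowDen t x‖ ^ 2 := by
  have hD := flowDen_ne_zero t x
  have hD' : (‖flowDen t x‖ : ℝ) ^ 2 ≠ 0 := by positivity
  have h1 : flowNum t x / flowDen t x
      = flowNum t x * conj (flowDen t x) / ((‖flowDen t x‖ ^ 2 : ℝ) : ℂ) := by
    rw [← Complex.normSq_eq_norm_sq, ← Complex.mul_conj]
    have : conj (flowDen t x) ≠ 0 := by simpa using hD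
    field_simp
  rw [h1, Complex.div_ofReal_im]
  congr 1
  have hd : x.dir.re ^ 2 + x.dir.im ^ 2 = 1 := by
    have := x.norm_dir
    rw [← sq_eq_sq₀ (norm_nonneg _) zero_le_one, ← Complex.normSq_eq_norm_sq,
      Complex.normSq_apply] at this
    linarith
  have hc := Real.cosh_sq_sub_sinh_sq (t / 2)
  simp only [flowNum, flowDen, map_add, map_mul, Complex.conj_I, Complex.conj_ofReal,
    Complex.mul_im, Complex.add_im, Complex.add_re, Complex.mul_re, Complex.ofReal_re,
    Complex.ofReal_im, Complex.I_re, Complex.I_im, Complex.conj_re, Complex.conj_im,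
    Complex.neg_re, Complex.neg_im, UpperHalfPlane.coe_re, UpperHalfPlane.coe_im]
  linear_combination x.pt.im * hc - x.pt.im * (Real.sinh (t / 2)) ^ 2 * hd

/-- The geodesic flow on the unit tangent bundle of the hyperbolic plane, written explicitly:
`flow t x` is the velocity vector at time `t` of the unit speed geodesic with initial vector `x`
(see `flow_zero`, `flow_add`, `hasDerivAt_flow_pt` and `isometry_flow_pt`). -/
def flow (t : ℝ) (x : T1H) : T1H :=
  ⟨(⟨flowNum t x / flowDen t x, by
      rw [im_flow]
      have := flowDen_ne_zero t x
      have := x.pt.im_pos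
      positivity⟩, x.vec / flowDen t x ^ 2), by
    change ‖x.vec / flowDen t x ^ 2‖ = (flowNum t x / flowDen t x).im
    rw [im_flow, norm_div, norm_pow, x.norm_vec]⟩

theorem flow_pt (t : ℝ) (x : T1H) : ((flow t x).pt : ℂ) = flowNum t x / flowDen t x := rfl

theorem flow_vec (t : ℝ) (x : T1H) : (flow t x).vec = x.vec / flowDen t x ^ 2 := rfl

theorem flow_im (t : ℝ) (x : T1H) : (flow t x).pt.im = x.pt.im / ‖flowDen t x‖ ^ 2 :=
  im_flow t x

theorem flow_zero (x : T1H) : flow 0 x = x := by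
  apply T1H.ext'
  · simp [flow_pt, flowNum, flowDen]
  · simp [flow_vec, flowDen]

theorem dir_flow (t : ℝ) (x : T1H) :
    (flow t x).dir = x.dir * conj (flowDen t x) / flowDen t x := by
  have hD := flowDen_ne_zero t x
  have hD' : conj (flowDen t x) ≠ 0 := by simpa using hD
  have hy : (x.pt.im : ℂ) ≠ 0 := by exact_mod_cast x.pt.im_ne_zero
  rw [T1H.dir, flow_im, flow_vec, x.vec_eq]
  push_cast
  rw [← Complex.ofReal_pow, ← Complex.normSq_eq_norm_sq, ← Complex.mul_conj]
  field_simp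

theorem flowDen_add (s t : ℝ) (x : T1H) :
    flowDen (s + t) x = flowDen s (flow t x) * flowDen t x := by
  have hD := flowDen_ne_zero t x
  have hd := x.dir_mul_conj
  rw [flowDen, flowDen, dir_flow]
  field_simp
  rw [add_div, Real.cosh_add, Real.sinh_add]
  simp only [flowDen, map_add, map_mul, Complex.conj_I, Complex.conj_ofReal]
  push_cast
  linear_combination
    Complex.sinh ((s : ℂ) / 2) * Complex.sinh ((t : ℂ) / 2) * Complex.I ^ 2 * hd
    + Complex.sinh ((s : ℂ) / 2) * Complex.sinh ((t : ℂ) / 2) * Complex.I_sq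

theorem flowNum_add (s t : ℝ) (x : T1H) :
    flowNum (s + t) x = flowNum s (flow t x) * flowDen t x := by
  have hD := flowDen_ne_zero t x
  have hD' : conj (flowDen t x) ≠ 0 := by simpa using hD
  have hd := x.dir_mul_conj
  rw [flowNum, flowNum, dir_flow, flow_pt, map_div₀]
  field_simp
  rw [add_div, Real.cosh_add, Real.sinh_add]
  simp only [flowNum, map_add, map_mul, Complex.conj_I, Complex.conj_ofReal, Complex.conj_conj]
  push_cast
  linear_combination
    x.pt * Complex.sinh ((s : ℂ) / 2) * Complex.sinh ((t : ℂ) / 2) * Complex.I ^ 2 * hd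
    + x.pt * Complex.sinh ((s : ℂ) / 2) * Complex.sinh ((t : ℂ) / 2) * Complex.I_sq

theorem flow_add (s t : ℝ) (x : T1H) : flow (s + t) x = flow s (flow t x) := by
  have hD := flowDen_ne_zero t x
  have hD' := flowDen_ne_zero s (flow t x)
  apply T1H.ext'
  · rw [flow_pt, flow_pt, flowNum_add, flowDen_add]
    field_simp
  · rw [flow_vec, flow_vec, flow_vec, flowDen_add, mul_pow, div_div, mul_comm]

theorem hasDerivAt_flow_pt (t : ℝ) (x : T1H) :
    HasDerivAt (fun s : ℝ => ((flow s x).pt : ℂ)) (flow t x).vec t := by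
  have hD := flowDen_ne_zero t x
  have hhalf : HasDerivAt (fun s : ℝ => s / 2) (1 / 2) t := (hasDerivAt_id t).div_const 2
  have hc := (hhalf.cosh).ofReal_comp
  have hs := (hhalf.sinh).ofReal_comp
  have hnum := (hc.const_mul (x.pt : ℂ)).add
    (hs.const_mul (Complex.I * x.dir * conj (x.pt : ℂ)))
  have hden := (hs.const_mul (Complex.I * x.dir)).const_add (0 : ℂ) |>.add hc
  have hden' : HasDerivAt (fun s : ℝ => flowDen s x) _ t :=
    hden.congr_of_eventuallyEq (Filter.Eventually.of_forall fun s => by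
      simp [flowDen]; ring)
  have hnum' : HasDerivAt (fun s : ℝ => flowNum s x) _ t := hnum
  refine (hnum'.div hden' hD).congr_deriv ?_
  rw [flow_vec, x.vec_eq]
  congr 1
  have hcs : (Real.cosh (t / 2) : ℂ) ^ 2 - (Real.sinh (t / 2) : ℂ) ^ 2 = 1 := by
    exact_mod_cast Real.cosh_sq_sub_sinh_sq (t / 2)
  have hz : conj (x.pt : ℂ) = x.pt - 2 * x.pt.im * Complex.I := by
    apply Complex.ext <;> simp; ring
  simp only [flowNum, flowDen, hz]
  push_cast at hcs ⊢
  linear_combination (x.dir * x.pt.im) * (-Complex.I ^ 2) * hcs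
    - x.dir * x.pt.im * Complex.I_sq

theorem dist_flow_pt (t : ℝ) (x : T1H) : dist x.pt (flow t x).pt = |t| := by
  have hD := flowDen_ne_zero t x
  have hD' : 0 < ‖flowDen t x‖ := norm_pos_iff.mpr hD
  have hy := x.pt.im_pos
  rw [UpperHalfPlane.dist_eq_iff_eq_sinh, flow_im, flow_pt, Complex.dist_eq]
  have hz : conj (x.pt : ℂ) = x.pt - 2 * x.pt.im * Complex.I := by
    apply Complex.ext <;> simp; ring
  have h1 : (x.pt : ℂ) - flowNum t x / flowDen t x
      = -(2 * x.pt.im * x.dir * Real.sinh (t / 2)) / flowDen t x := by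
    field_simp
    rw [flowNum, hz, flowDen]
    linear_combination 2 * x.dir * x.pt.im * (Real.sinh (t / 2) : ℂ) * Complex.I_sq
  have h2 : Real.sqrt (x.pt.im * (x.pt.im / ‖flowDen t x‖ ^ 2)) = x.pt.im / ‖flowDen t x‖ := by
    rw [show x.pt.im * (x.pt.im / ‖flowDen t x‖ ^ 2) = (x.pt.im / ‖flowDen t x‖) ^ 2 by ring,
      Real.sqrt_sq (by positivity)]
  have h3 : Real.sinh (|t| / 2) = |Real.sinh (t / 2)| := by
    rw [Real.abs_sinh, abs_div, abs_two]
  rw [h1, h2, h3]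
  simp only [norm_div, norm_neg, norm_mul, x.norm_dir, Complex.norm_real, Complex.norm_two,
    Real.norm_eq_abs, abs_of_pos hy, mul_one]
  field_simp

/-- The orbits of the flow project to unit speed geodesic lines of the hyperbolic plane. -/
theorem isometry_flow_pt (x : T1H) : Isometry (fun t : ℝ => (flow t x).pt) := by
  refine Isometry.of_dist_eq fun s t => ?_
  have h : flow t x = flow (t - s) (flow s x) := by rw [← flow_add, sub_add_cancel]
  rw [h, dist_flow_pt, Real.dist_eq, abs_sub_comm]

theorem dir_smul (g : SL(2, ℝ)) (x : T1H) :
    (g • x).dir = x.dir * conj (cocyc g x.pt) / cocyc g x.pt := by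
  have hj := cocyc_ne_zero g x.pt
  have hj' : conj (cocyc g x.pt) ≠ 0 := by simpa using hj
  have hy : (x.pt.im : ℂ) ≠ 0 := by exact_mod_cast x.pt.im_ne_zero
  rw [T1H.dir, smul_vec, smul_pt, im_smul_eq, x.vec_eq]
  push_cast
  rw [← Complex.ofReal_pow, ← Complex.normSq_eq_norm_sq, ← Complex.mul_conj]
  field_simp

theorem cocyc_flow (t : ℝ) (g : SL(2, ℝ)) (x : T1H) :
    flowDen t (g • x) * cocyc g x.pt = cocyc g (flow t x).pt * flowDen t x := by
  have hj := cocyc_ne_zero g x.pt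
  have hD := flowDen_ne_zero t x
  have h1 : cocyc g (flow t x).pt
      = (g 1 0 : ℂ) * (flowNum t x / flowDen t x) + (g 1 1 : ℂ) := rfl
  rw [h1, flowDen, dir_smul]
  field_simp
  simp only [cocyc, flowNum, flowDen, map_add, map_mul, Complex.conj_ofReal]
  ring

theorem num_flow (t : ℝ) (g : SL(2, ℝ)) (x : T1H) :
    flowNum t (g • x) * cocyc g x.pt
      = (g 0 0 : ℂ) * flowNum t x + (g 0 1 : ℂ) * flowDen t x := by
  have hj := cocyc_ne_zero g x.pt
  have hj' : conj (cocyc g x.pt) ≠ 0 := by simpa using hj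
  rw [flowNum, dir_smul, smul_pt, coe_smul_eq, map_div₀]
  field_simp
  simp only [flowNum, flowDen, map_add, map_mul, Complex.conj_ofReal]
  ring

/-- The geodesic flow commutes with the action of `SL(2, ℝ)`. -/
theorem flow_smul (t : ℝ) (g : SL(2, ℝ)) (x : T1H) : flow t (g • x) = g • flow t x := by
  have hj := cocyc_ne_zero g x.pt
  have hj' := cocyc_ne_zero g (flow t x).pt
  have hD := flowDen_ne_zero t x
  have hD' := flowDen_ne_zero t (g • x)
  have h1 := cocyc_flow t g x
  have h2 := num_flow t g x
  apply T1H.ext'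
  · rw [smul_pt, coe_smul_eq, flow_pt, flow_pt, div_eq_div_iff hD' hj']
    apply mul_right_cancel₀ (mul_ne_zero hj hD)
    have h3 : (g 0 0 : ℂ) * (flowNum t x / flowDen t x) + (g 0 1 : ℂ)
        = flowNum t (g • x) * cocyc g x.pt / flowDen t x := by
      rw [h2]; field_simp
    rw [h3]
    field_simp
    linear_combination (-flowNum t (g • x)) * h1
  · rw [smul_vec, flow_vec, flow_vec, smul_vec, div_div, div_div, ← mul_pow, ← mul_pow,
      mul_comm (cocyc g x.pt), h1, mul_comm]

/-! ## Closed hyperbolic surfaces and their closed geodesics -/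

/-- `Γ` is discrete, acts on `ℍ` without fixed points (up to `± 1`, which acts trivially) and
cocompactly. The quotients `Γ \ ℍ` are precisely the closed connected oriented hyperbolic
surfaces, `Γ` being the full preimage in `SL(2, ℝ)`, or a lift to `SL(2, ℝ)`, of the image in
`PSL(2, ℝ)` of a Fuchsian representation of the fundamental group. -/
structure IsClosedSurfaceGroup (Γ : Subgroup SL(2, ℝ)) : Prop where
  discrete : DiscreteTopology Γ
  free : ∀ g ∈ Γ, ∀ z : ℍ, g • z = z → g = 1 ∨ g = -1
  cocompact : CompactSpace (MulAction.orbitRel.Quotient Γ ℍ)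

variable (Γ : Subgroup SL(2, ℝ))

/-- The surface `S = Γ \ ℍ`. -/
abbrev Surface : Type := MulAction.orbitRel.Quotient Γ ℍ

/-- The unit tangent bundle `T¹S = Γ \ T¹ℍ`, with the quotient topology. -/
abbrev T1S : Type := MulAction.orbitRel.Quotient Γ T1H

variable {Γ}

/-- The footpoint projection `T¹S → S`. -/
def footpoint : T1S Γ → Surface Γ :=
  Quotient.map T1H.pt (by
    rintro x y ⟨g, rfl⟩
    exact ⟨g, rfl⟩)

/-- The geodesic flow on `T¹S`. -/
def geodesicFlow (t : ℝ) : T1S Γ → T1S Γ :=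
  Quotient.map (flow t) (by
    rintro x y ⟨g, rfl⟩
    exact ⟨g, (flow_smul t (g : SL(2, ℝ)) y).symm⟩)

/-- A closed geodesic of `S`, as a subset of `T¹S`: a periodic orbit of the geodesic flow. -/
def IsClosedGeodesic (c : Set (T1S Γ)) : Prop :=
  ∃ v : T1S Γ, (∃ T : ℝ, 0 < T ∧ geodesicFlow T v = v) ∧ c = Set.range fun t => geodesicFlow t v

/-- The self-intersections of a closed geodesic: unordered pairs of distinct points of the orbit
`c` (that is, of distinct times in one period) with the same projection to `S`. -/
def selfIntersections (c : Set (T1S Γ)) : Set (Sym2 (T1S Γ)) :=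
  {e | ∃ v ∈ c, ∃ w ∈ c, v ≠ w ∧ footpoint v = footpoint w ∧ e = s(v, w)}

/-- The number of self-intersections of a closed geodesic. -/
def numSelfIntersections (c : Set (T1S Γ)) : ℕ∞ := (selfIntersections c).encard

variable (Γ) in
/-- `𝓕_p(S)`: the closure in `T¹S` of the union of all closed geodesics with at most `p`
self-intersections. -/
def geodesicsAtMost (p : ℕ) : Set (T1S Γ) :=
  closure (⋃₀ {c | IsClosedGeodesic c ∧ numSelfIntersections c ≤ p})

end HypSurface

end

noncomputable section

namespace HypSurface

open Filter Topology

/-! ## Topology of the unit tangent bundle -/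

/-! The number of self-intersections of the orbit through a point is lower semicontinuous on `T1S Γ`
(`eventually_lt_numSelfIntersections`). So every point of a geodesic with more than `p`
self-intersections has a neighbourhood whose points all lie on orbits with more than `p`. This
neighbourhood misses every closed geodesic with at most `p`, hence their closure.

Semicontinuity rests on three facts. A self-intersection is transverse: two distinct unit vectors at
one point are otherwise opposite, and `smul_flow_ne_opp` excludes an orbit that returns to its own
opposite, because the deck transformation would reverse the vector halfway and so fix its footpoint.
A transverse crossing survives small perturbations (`eventually_crossing`), by the intermediate
value theorem in a disk chart. Finitely many self-intersections stay distinct after perturbation,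
since `T1S Γ` is Hausdorff. -/

@[fun_prop]
theorem T1H.continuous_pt : Continuous T1H.pt := continuous_fst.comp continuous_subtype_val

@[fun_prop]
theorem T1H.continuous_vec : Continuous T1H.vec := continuous_snd.comp continuous_subtype_val

theorem T1H.continuous_iff {X : Type*} [TopologicalSpace X] {f : X → T1H} :
    Continuous f ↔ Continuous (fun a => ((f a).pt : ℂ)) ∧ Continuous fun a => (f a).vec := by
  refine ⟨fun h => ⟨UpperHalfPlane.continuous_coe.comp (T1H.continuous_pt.comp h),
    T1H.continuous_vec.comp h⟩, fun h => ?_⟩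
  exact Continuous.subtype_mk
    ((UpperHalfPlane.isEmbedding_coe.continuous_iff.mpr h.1).prodMk h.2) fun a => (f a).2

@[fun_prop]
theorem T1H.continuous_dir : Continuous T1H.dir :=
  T1H.continuous_vec.div (Complex.continuous_ofReal.comp
    (UpperHalfPlane.continuous_im.comp T1H.continuous_pt))
    fun x => by exact_mod_cast x.pt.im_ne_zero

theorem continuous_flow : Continuous fun p : ℝ × T1H => flow p.1 p.2 := by
  have hd : Continuous fun p : ℝ × T1H => p.2.dir := T1H.continuous_dir.comp continuous_snd
  have hz : Continuous fun p : ℝ × T1H => (p.2.pt : ℂ) :=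
    UpperHalfPlane.continuous_coe.comp (T1H.continuous_pt.comp continuous_snd)
  have hv : Continuous fun p : ℝ × T1H => p.2.vec := T1H.continuous_vec.comp continuous_snd
  have hnum : Continuous fun p : ℝ × T1H => flowNum p.1 p.2 := by
    unfold flowNum; fun_prop
  have hden : Continuous fun p : ℝ × T1H => flowDen p.1 p.2 := by
    unfold flowDen; fun_prop
  exact T1H.continuous_iff.mpr ⟨hnum.div hden fun p => flowDen_ne_zero _ _,
    hv.div (hden.pow 2) fun p => pow_ne_zero 2 (flowDen_ne_zero _ _)⟩

@[fun_prop]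
theorem _root_.Continuous.hypFlow {X : Type*} [TopologicalSpace X] {f : X → ℝ} {g : X → T1H}
    (hf : Continuous f) (hg : Continuous g) : Continuous fun a => flow (f a) (g a) :=
  continuous_flow.comp (hf.prodMk hg)

instance : ContinuousConstSMul SL(2, ℝ) T1H where
  continuous_const_smul g := by
    have hz : Continuous fun x : T1H => (x.pt : ℂ) :=
      UpperHalfPlane.continuous_coe.comp T1H.continuous_pt
    have hj : Continuous fun x : T1H => cocyc g x.pt := by
      unfold cocyc; fun_prop
    exact T1H.continuous_iff.mpr ⟨UpperHalfPlane.continuous_coe.comp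
      ((continuous_const_smul g).comp T1H.continuous_pt),
      T1H.continuous_vec.div (hj.pow 2) fun x => pow_ne_zero 2 (cocyc_ne_zero _ _)⟩

instance : LocallyCompactSpace T1H :=
  (isClosed_eq (f := fun x : ℍ × ℂ => ‖x.2‖) (g := fun x => x.1.im) (by fun_prop)
    (UpperHalfPlane.continuous_im.comp continuous_fst)).isClosedEmbedding_subtypeVal
    |>.locallyCompactSpace

instance (Γ : Subgroup SL(2, ℝ)) : ContinuousConstSMul Γ T1H where
  continuous_const_smul g := continuous_const_smul (g : SL(2, ℝ))

/-- Inherited from `ℍ`: an element carrying a point of `K` into `L` does the same for the compact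
sets of footpoints. -/
instance (Γ : Subgroup SL(2, ℝ)) [DiscreteTopology Γ] : ProperlyDiscontinuousSMul Γ T1H where
  finite_disjoint_inter_image {K L} hK hL := by
    refine (ProperlyDiscontinuousSMul.finite_disjoint_inter_image (Γ := Γ)
      (hK.image T1H.continuous_pt) (hL.image T1H.continuous_pt)).subset ?_
    rintro g ⟨_, ⟨x, hx, rfl⟩, hxL⟩
    exact ⟨g • x.pt, ⟨x.pt, ⟨x, hx, rfl⟩, rfl⟩, ⟨g • x, hxL, rfl⟩⟩

instance (Γ : Subgroup SL(2, ℝ)) [DiscreteTopology Γ] : T2Space (T1S Γ) :=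
  t2Space_of_properlyDiscontinuousSMul_of_t2Space

/-! ## Persistence of transverse crossings of geodesics -/

/-- The position of a point in the Poincaré disk, after the isometry of `ℍ` with the disk that
takes `x` to the unit vector at `0` pointing to `1`. -/
def diskCoord (x : T1H) (w : ℍ) : ℂ :=
  Complex.I * conj x.dir * ((w : ℂ) - x.pt) / ((w : ℂ) - conj (x.pt : ℂ))

theorem sub_conj_ne_zero (w z : ℍ) : (w : ℂ) - conj (z : ℂ) ≠ 0 := by
  intro h
  have h1 := congrArg Complex.im h
  simp only [Complex.sub_im, Complex.conj_im, UpperHalfPlane.coe_im, Complex.zero_im] at h1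
  linarith [w.im_pos, z.im_pos]

@[fun_prop]
theorem _root_.Continuous.hypDiskCoord {X : Type*} [TopologicalSpace X] {f : X → T1H} {g : X → ℍ}
    (hf : Continuous f) (hg : Continuous g) : Continuous fun a => diskCoord (f a) (g a) := by
  unfold diskCoord
  have hz' : Continuous fun a => conj ((f a).pt : ℂ) :=
    Complex.continuous_conj.comp (UpperHalfPlane.continuous_coe.comp (by fun_prop))
  have hd' : Continuous fun a => conj (f a).dir := Complex.continuous_conj.comp (by fun_prop)
  refine Continuous.div (by fun_prop) (by fun_prop) fun a => sub_conj_ne_zero _ _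

theorem norm_diskCoord_lt_one (x : T1H) (w : ℍ) : ‖diskCoord x w‖ < 1 := by
  have h := UpperHalfPlane.tanh_half_dist w x.pt
  rw [Complex.dist_eq, Complex.dist_eq] at h
  rw [diskCoord, norm_div, norm_mul, norm_mul, Complex.norm_I, RCLike.norm_conj, x.norm_dir,
    one_mul, one_mul, ← h]
  exact Real.tanh_lt_one _

/-- Geodesics through the centre of the disk are diameters. The one of `y` makes with the real axis,
which is the geodesic of `x`, the angle from `x` to `y`. -/
theorem diskCoord_flow {x y : T1H} (h : x.pt = y.pt) (t : ℝ) :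
    diskCoord x (flow t y).pt = conj x.dir * y.dir * (Real.tanh (t / 2) : ℝ) := by
  have hD := flowDen_ne_zero t y
  have hN := sub_conj_ne_zero (flow t y).pt y.pt
  have hc : (Real.cosh (t / 2) : ℂ) ≠ 0 := by exact_mod_cast (Real.cosh_pos _).ne'
  rw [diskCoord, h, div_eq_iff hN, flow_pt, Real.tanh_eq_sinh_div_cosh, Complex.ofReal_div]
  field_simp
  rw [flowNum, flowDen]
  linear_combination conj x.dir * y.dir * Real.cosh (t / 2) * Real.sinh (t / 2)
    * (conj (y.pt : ℂ) - y.pt) * Complex.I_sq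

theorem diskCoord_injective (x : T1H) : Function.Injective (diskCoord x) := by
  intro w w' h
  have hw := sub_conj_ne_zero w x.pt
  have hw' := sub_conj_ne_zero w' x.pt
  have hz := sub_conj_ne_zero x.pt x.pt
  have hd : conj x.dir ≠ 0 := by
    intro h0
    have := x.dir_mul_conj
    rw [h0, mul_zero] at this
    exact zero_ne_one this
  rw [diskCoord, diskCoord, div_eq_div_iff hw hw'] at h
  apply UpperHalfPlane.ext
  rw [← sub_eq_zero]
  -- The factor cancelled is the determinant of the Möbius map `diskCoord x`.
  apply mul_left_cancel₀ (mul_ne_zero (mul_ne_zero Complex.I_ne_zero hd) hz)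
  linear_combination h

theorem exists_flow_pt_eq {x : T1H} {w : ℍ} (h : (diskCoord x w).im = 0) :
    ∃ t, (flow t x).pt = w := by
  have h1 : (((diskCoord x w).re : ℝ) : ℂ) = diskCoord x w := Complex.ext rfl h.symm
  have h2 := norm_diskCoord_lt_one x w
  rw [← h1, Complex.norm_real, Real.norm_eq_abs, abs_lt] at h2
  refine ⟨2 * Real.artanh (diskCoord x w).re, diskCoord_injective x ?_⟩
  rw [diskCoord_flow rfl, mul_div_cancel_left₀ _ two_ne_zero, Real.tanh_artanh h2, h1,
    mul_comm (conj _), x.dir_mul_conj, one_mul]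

/-- Joint continuity of the flow at `(0, z)`; the point is that one `δ` serves all nearby `z'`. -/
theorem exists_forall_abs_lt_flow_mem {z : T1H} {W : Set T1H} (hW : W ∈ 𝓝 z) :
    ∃ δ > 0, ∀ᶠ z' in 𝓝 z, ∀ s : ℝ, |s| < δ → flow s z' ∈ W := by
  have h1 : ∀ᶠ p : ℝ × T1H in 𝓝 (0, z), flow p.1 p.2 ∈ W :=
    continuous_flow.continuousAt (x := ((0 : ℝ), z)) |>.eventually_mem
      (by simpa only [flow_zero] using hW)
  rw [nhds_prod_eq] at h1
  obtain ⟨P, hP, Q, hQ, hPQ⟩ := Filter.eventually_prod_iff.mp h1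
  obtain ⟨δ, hδ, hball⟩ := Metric.eventually_nhds_iff.mp hP
  refine ⟨δ, hδ, hQ.mono fun z' hz' s hs => hPQ (hball ?_) hz'⟩
  simpa using hs

/-- Geodesics that cross transversely at the footpoints of `x` and `y` still cross, close to the
footpoints, after a perturbation. -/
theorem eventually_crossing {x y : T1H} (h : x.pt = y.pt) (ht : (conj x.dir * y.dir).im ≠ 0)
    {U V : Set T1H} (hU : U ∈ 𝓝 x) (hV : V ∈ 𝓝 y) :
    ∀ᶠ q : T1H × T1H in 𝓝 (x, y),
      ∃ s t, flow s q.1 ∈ U ∧ flow t q.2 ∈ V ∧ (flow s q.1).pt = (flow t q.2).pt := by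
  obtain ⟨δ₁, hδ₁, hx⟩ := exists_forall_abs_lt_flow_mem hU
  obtain ⟨δ₂, hδ₂, hy⟩ := exists_forall_abs_lt_flow_mem hV
  obtain ⟨ε, hε, hε₁, hε₂⟩ : ∃ ε > 0, ε < δ₁ / 2 ∧ ε < δ₂ := by
    refine ⟨min (δ₁ / 2) δ₂ / 2, by positivity, ?_, ?_⟩
    · linarith [min_le_left (δ₁ / 2) δ₂, half_lt_self (half_pos hδ₁)]
    · linarith [min_le_right (δ₁ / 2) δ₂]
  -- The second geodesic passes from one side of the first to the other between times `-ε` and `ε`.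
  -- This is an open condition, and at `(x, y)` the product is minus a nonzero square by
  -- transversality.
  have hneg : ∀ᶠ q : T1H × T1H in 𝓝 (x, y),
      (diskCoord q.1 (flow ε q.2).pt).im * (diskCoord q.1 (flow (-ε) q.2).pt).im < 0 := by
    have hcont : Continuous fun q : T1H × T1H =>
        (diskCoord q.1 (flow ε q.2).pt).im * (diskCoord q.1 (flow (-ε) q.2).pt).im := by
      fun_prop
    refine hcont.continuousAt.eventually_lt continuousAt_const ?_
    dsimp only
    rw [diskCoord_flow h, diskCoord_flow h, Complex.im_mul_ofReal, Complex.im_mul_ofReal,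
      neg_div, Real.tanh_neg]
    have h0 : 0 < Real.tanh (ε / 2) := by
      rw [Real.tanh_eq_sinh_div_cosh]
      exact div_pos (Real.sinh_pos_iff.mpr (half_pos hε)) (Real.cosh_pos _)
    have := mul_pos (sq_pos_of_ne_zero ht) (pow_pos h0 2)
    linarith
  have hdist : ∀ᶠ q : T1H × T1H in 𝓝 (x, y), dist q.1.pt q.2.pt < δ₁ / 2 := by
    refine ContinuousAt.eventually_lt (Continuous.continuousAt ?_) continuousAt_const ?_
    · exact (T1H.continuous_pt.comp continuous_fst).dist (T1H.continuous_pt.comp continuous_snd)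
    · simpa [h] using hδ₁
  filter_upwards [hneg, hdist, continuousAt_fst.eventually hx, continuousAt_snd.eventually hy]
    with q hq1 hq2 hqx hqy
  obtain ⟨t, ht, ht0⟩ : ∃ t ∈ Set.uIcc (-ε) ε, (diskCoord q.1 (flow t q.2).pt).im = 0 := by
    have hcont : Continuous fun t : ℝ => (diskCoord q.1 (flow t q.2).pt).im := by
      fun_prop
    refine intermediate_value_uIcc hcont.continuousOn ?_
    rcases mul_neg_iff.mp hq1 with ⟨h1, h2⟩ | ⟨h1, h2⟩
    · exact Set.mem_uIcc_of_le h2.le h1.le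
    · exact Set.mem_uIcc_of_ge h1.le h2.le
  rw [Set.uIcc_of_le (by linarith)] at ht
  replace ht := abs_le.mpr ht
  obtain ⟨s, hs⟩ := exists_flow_pt_eq ht0
  -- The time `s` is bounded by the triangle inequality: `|s|` is at most the distance of the
  -- footpoints plus `|t|`, each less than or bounded by a quantity below `δ₁ / 2`.
  refine ⟨s, t, hqx s ?_, hqy t (by linarith), hs⟩
  rw [← dist_flow_pt s q.1, hs]
  have := dist_triangle q.1.pt q.2.pt (flow t q.2).pt
  rw [dist_flow_pt] at this
  linarith

/-! ## Self-crossings are transverse -/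

/-- The opposite of a unit tangent vector. -/
def T1H.opp (x : T1H) : T1H := ⟨(x.pt, -x.vec), by rw [norm_neg]; exact x.2⟩

theorem T1H.opp_ne (x : T1H) : x.opp ≠ x := by
  intro h
  have h1 : -x.vec = x.vec := congrArg T1H.vec h
  have h2 : x.vec ≠ 0 := norm_pos_iff.mp (x.norm_vec ▸ x.pt.im_pos)
  exact h2 (self_eq_neg.mp h1.symm)

theorem T1H.dir_opp (x : T1H) : x.opp.dir = -x.dir := neg_div _ _

theorem flow_opp (t : ℝ) (x : T1H) : flow t x.opp = (flow (-t) x).opp := by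
  have hD : flowDen t x.opp = flowDen (-t) x := by
    simp only [flowDen, T1H.dir_opp, neg_div, Real.cosh_neg, Real.sinh_neg]; push_cast; ring
  have hN : flowNum t x.opp = flowNum (-t) x := by
    simp only [flowNum, T1H.dir_opp, neg_div, Real.cosh_neg, Real.sinh_neg,
      show x.opp.pt = x.pt from rfl]
    push_cast; ring
  apply T1H.ext'
  · change flowNum t x.opp / flowDen t x.opp = flowNum (-t) x / flowDen (-t) x
    rw [hD, hN]
  · change -x.vec / flowDen t x.opp ^ 2 = -(x.vec / flowDen (-t) x ^ 2)
    rw [hD, neg_div]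

/-- The quotient of the directions, `conj x.dir * y.dir`, has modulus one, so if real it is `1` or
`-1`. -/
theorem T1H.eq_or_eq_opp {x y : T1H} (h : x.pt = y.pt) (ht : (conj x.dir * y.dir).im = 0) :
    y = x ∨ y = x.opp := by
  have h1 : (((conj x.dir * y.dir).re : ℝ) : ℂ) = conj x.dir * y.dir := Complex.ext rfl ht.symm
  have h2 : |(conj x.dir * y.dir).re| = 1 := by
    rw [← Real.norm_eq_abs, ← Complex.norm_real, h1, norm_mul, RCLike.norm_conj, x.norm_dir,
      y.norm_dir, one_mul]
  have h3 : y.dir = x.dir * ((conj x.dir * y.dir).re : ℝ) := by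
    rw [h1]
    linear_combination (-y.dir) * x.dir_mul_conj
  rcases (abs_eq zero_le_one).mp h2 with h4 | h4
  · left
    refine T1H.ext' (congrArg _ h.symm) ?_
    rw [y.vec_eq, x.vec_eq, h3, h4, h]; simp
  · right
    refine T1H.ext' (congrArg _ h.symm) ?_
    change _ = -x.vec
    rw [y.vec_eq, x.vec_eq, h3, h4, h]; simp

variable {Γ : Subgroup SL(2, ℝ)}

theorem IsClosedSurfaceGroup.smul_flow_ne_opp (hΓ : IsClosedSurfaceGroup Γ) {g : SL(2, ℝ)}
    (hg : g ∈ Γ) (t : ℝ) (x : T1H) : g • flow t x ≠ x.opp := by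
  intro h
  -- Flowing both sides back by `t / 2` meets at the midpoint of the segment, where `g` reverses the
  -- vector and so fixes the footpoint. Freeness leaves `g = 1` or `g = -1`, which reverse nothing.
  have h1 : g • flow (t / 2) x = (flow (t / 2) x).opp := by
    have h2 := congrArg (flow (-(t / 2))) h
    rwa [flow_smul, ← flow_add, flow_opp, neg_neg, show -(t / 2) + t = t / 2 by ring] at h2
  refine T1H.opp_ne (flow (t / 2) x) (h1.symm.trans ?_)
  have hpt : g • (flow (t / 2) x).pt = (flow (t / 2) x).pt := congrArg T1H.pt h1
  rcases hΓ.free g hg _ hpt with rfl | rfl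
  · exact one_smul _ _
  · refine T1H.ext' (congrArg _ hpt) ?_
    rw [smul_vec]
    simp [cocyc]

/-! ## Persistence of self-intersections -/

/-- The projection of the unit tangent bundle of `ℍ` to that of the surface. -/
def toT1S (Γ : Subgroup SL(2, ℝ)) : T1H → T1S Γ := Quotient.mk _

theorem isOpenQuotientMap_toT1S : IsOpenQuotientMap (toT1S Γ) :=
  MulAction.isOpenQuotientMap_quotientMk

theorem geodesicFlow_toT1S (t : ℝ) (x : T1H) :
    geodesicFlow t (toT1S Γ x) = toT1S Γ (flow t x) := rfl

theorem geodesicFlow_add (s t : ℝ) (v : T1S Γ) :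
    geodesicFlow (s + t) v = geodesicFlow s (geodesicFlow t v) := by
  obtain ⟨x, rfl⟩ := isOpenQuotientMap_toT1S.surjective v
  simp only [geodesicFlow_toT1S, flow_add]

theorem toT1S_smul {g : SL(2, ℝ)} (hg : g ∈ Γ) (x : T1H) : toT1S Γ (g • x) = toT1S Γ x :=
  Quotient.sound ⟨⟨g, hg⟩, rfl⟩

theorem footpoint_toT1S_eq_iff {x y : T1H} :
    footpoint (toT1S Γ x) = footpoint (toT1S Γ y) ↔ ∃ g ∈ Γ, g • y.pt = x.pt := by
  refine Quotient.eq.trans (MulAction.orbitRel_apply.trans ?_)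
  exact ⟨fun ⟨g, hg⟩ => ⟨g, g.2, hg⟩, fun ⟨g, hg, h⟩ => ⟨⟨g, hg⟩, h⟩⟩

/-- Upstairs, the self-intersection is a crossing of the geodesic of `x` with its translate by some
`g` in `Γ`. The same `g` serves for all nearby geodesics. -/
theorem IsClosedSurfaceGroup.eventually_selfIntersection (hΓ : IsClosedSurfaceGroup Γ)
    {v : T1S Γ} {s t : ℝ} (hne : geodesicFlow s v ≠ geodesicFlow t v)
    (hfoot : footpoint (geodesicFlow s v) = footpoint (geodesicFlow t v))
    {A B : Set (T1S Γ)} (hA : A ∈ 𝓝 (geodesicFlow s v)) (hB : B ∈ 𝓝 (geodesicFlow t v)) :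
    ∀ᶠ u in 𝓝 v, ∃ s' t', geodesicFlow s' u ∈ A ∧ geodesicFlow t' u ∈ B ∧
      footpoint (geodesicFlow s' u) = footpoint (geodesicFlow t' u) := by
  obtain ⟨x, rfl⟩ := isOpenQuotientMap_toT1S.surjective v
  simp only [geodesicFlow_toT1S] at hne hfoot hA hB
  obtain ⟨g, hg, hgpt⟩ := footpoint_toT1S_eq_iff.mp hfoot
  have htrans : (conj (flow s x).dir * (g • flow t x).dir).im ≠ 0 := by
    intro h0
    rcases T1H.eq_or_eq_opp hgpt.symm h0 with h1 | h1
    · exact hne (by rw [← toT1S_smul hg (flow t x), h1])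
    · refine hΓ.smul_flow_ne_opp hg (t - s) (flow s x) ?_
      rwa [← flow_add, sub_add_cancel]
  have hA' : toT1S Γ ⁻¹' A ∈ 𝓝 (flow s x) :=
    isOpenQuotientMap_toT1S.continuous.continuousAt.preimage_mem_nhds hA
  have hB' : toT1S Γ ⁻¹' B ∈ 𝓝 (g • flow t x) :=
    isOpenQuotientMap_toT1S.continuous.continuousAt.preimage_mem_nhds
      (by rwa [toT1S_smul hg])
  have hcross := eventually_crossing hgpt.symm htrans hA' hB'
  have hflow : ∀ r : ℝ, Continuous (flow r) := fun r =>
    continuous_flow.comp (continuous_const.prodMk continuous_id)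
  have hcont : Continuous fun x' : T1H => (flow s x', g • flow t x') :=
    (hflow s).prodMk ((hflow t).const_smul g)
  rw [← isOpenQuotientMap_toT1S.map_nhds_eq, Filter.eventually_map]
  filter_upwards [hcont.continuousAt.eventually hcross] with x' hx'
  obtain ⟨a, b, ha, hb, hab⟩ := hx'
  simp only [flow_smul, ← flow_add] at ha hb hab
  refine ⟨a + s, b + t, ha, ?_, footpoint_toT1S_eq_iff.mpr ⟨g, hg, hab.symm⟩⟩
  rwa [Set.mem_preimage, toT1S_smul hg] at hb

/-- The number of self-intersections of the orbits of the geodesic flow is lower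
semicontinuous. -/
theorem IsClosedSurfaceGroup.eventually_lt_numSelfIntersections (hΓ : IsClosedSurfaceGroup Γ)
    {p : ℕ} {v : T1S Γ}
    (hv : (p : ℕ∞) < numSelfIntersections (Set.range fun t => geodesicFlow t v)) :
    ∀ᶠ u in 𝓝 v, (p : ℕ∞) < numSelfIntersections (Set.range fun t => geodesicFlow t u) := by
  have := hΓ.discrete
  -- The total may be infinite, so exactly `p + 1` self-intersections are followed.
  obtain ⟨F, hF, hFcard⟩ := Set.exists_subset_encard_eq (Order.add_one_le_of_lt hv)
  have hFfin : F.Finite := Set.finite_of_encard_eq_coe (k := p + 1) (by exact_mod_cast hFcard)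
  have hdata : ∀ e : F, ∃ st : ℝ × ℝ, geodesicFlow st.1 v ≠ geodesicFlow st.2 v ∧
      footpoint (geodesicFlow st.1 v) = footpoint (geodesicFlow st.2 v) ∧
      (e : Sym2 (T1S Γ)) = s(geodesicFlow st.1 v, geodesicFlow st.2 v) := by
    rintro ⟨e, he⟩
    obtain ⟨_, ⟨s, rfl⟩, _, ⟨t, rfl⟩, h⟩ := hF he
    exact ⟨(s, t), h⟩
  choose st hne hfoot heq using hdata
  have : Finite F := hFfin
  have hPfin : (Set.range (fun e : F => geodesicFlow (st e).1 v) ∪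
      Set.range (fun e : F => geodesicFlow (st e).2 v)).Finite :=
    (Set.finite_range _).union (Set.finite_range _)
  -- Disjoint neighbourhoods of all the vectors involved: a perturbed vector then determines the
  -- original one, so distinct pairs stay distinct and the two members of a pair do not merge.
  obtain ⟨U, hU, hdisj⟩ := hPfin.t2_separation
  have hmem₁ := fun e : F => Set.mem_union_left
    (Set.range fun e : F => geodesicFlow (st e).2 v) (Set.mem_range_self (f := fun e : F =>
      geodesicFlow (st e).1 v) e)
  have hmem₂ := fun e : F => Set.mem_union_right
    (Set.range fun e : F => geodesicFlow (st e).1 v) (Set.mem_range_self (f := fun e : F =>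
      geodesicFlow (st e).2 v) e)
  have huniq : ∀ {a b q : T1S Γ}, a ∈ _ → b ∈ _ → q ∈ U a → q ∈ U b → a = b :=
    fun ha hb hqa hqb => hdisj.elim_set ha hb _ hqa hqb
  have hev := Filter.eventually_all.mpr fun e : F => hΓ.eventually_selfIntersection (hne e)
    (hfoot e) ((hU _).2.mem_nhds (hU _).1) ((hU _).2.mem_nhds (hU _).1)
  filter_upwards [hev] with u hu
  choose a b ha hb hab using hu
  let f : F → Sym2 (T1S Γ) := fun e => s(geodesicFlow (a e) u, geodesicFlow (b e) u)
  have hf : Function.Injective f := by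
    intro e e' h
    apply Subtype.ext
    rw [heq, heq, Sym2.eq_iff]
    rcases Sym2.eq_iff.mp h with ⟨h1, h2⟩ | ⟨h1, h2⟩
    · exact Or.inl ⟨huniq (hmem₁ e) (hmem₁ e') (ha e) (h1 ▸ ha e'),
        huniq (hmem₂ e) (hmem₂ e') (hb e) (h2 ▸ hb e')⟩
    · exact Or.inr ⟨huniq (hmem₁ e) (hmem₂ e') (ha e) (h1 ▸ hb e'),
        huniq (hmem₂ e) (hmem₁ e') (hb e) (h2 ▸ ha e')⟩
  have hsub : Set.range f ⊆ selfIntersections (Set.range fun t => geodesicFlow t u) := by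
    rintro _ ⟨e, rfl⟩
    refine ⟨_, ⟨a e, rfl⟩, _, ⟨b e, rfl⟩, fun h => hne e ?_, hab e, rfl⟩
    exact huniq (hmem₁ e) (hmem₂ e) (ha e) (Eq.mpr (congrArg (· ∈ _) h) (hb e))
  calc (p : ℕ∞) < (p + 1 : ℕ) := by exact_mod_cast Nat.lt_succ_self p
    _ = (Set.range f).encard := by
        rw [← Set.image_univ, hf.encard_image, Set.encard_univ, ENat.card_coe_set_eq, hFcard]
        rfl
    _ ≤ _ := Set.encard_le_encard hsub

theorem range_geodesicFlow_eq (t : ℝ) (v : T1S Γ) :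
    (Set.range fun s => geodesicFlow s (geodesicFlow t v)) =
      Set.range fun s => geodesicFlow s v := by
  simp only [← geodesicFlow_add]
  exact (Equiv.addRight t).surjective.range_comp fun s => geodesicFlow s v

end HypSurface

end

theorem mainTheorem11 (Γ : Subgroup SL(2, ℝ)) (hΓ : HypSurface.IsClosedSurfaceGroup Γ)
    (p : ℕ) (c : Set (HypSurface.T1S Γ)) (hc : HypSurface.IsClosedGeodesic c)
    (hp : (p : ℕ∞) < HypSurface.numSelfIntersections c) :
    c ⊆ (HypSurface.geodesicsAtMost Γ p)ᶜ := by
  obtain ⟨v, -, rfl⟩ := hc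
  rintro _ ⟨t, rfl⟩ hmem
  -- The orbit is based anew at the point assumed to lie in the closure, where semicontinuity is to
  -- be applied.
  rw [← HypSurface.range_geodesicFlow_eq t v] at hp
  obtain ⟨u, hu, c', ⟨⟨v', -, rfl⟩, hle⟩, t', rfl⟩ :=
    (mem_closure_iff_frequently.mp hmem).and_eventually
      (hΓ.eventually_lt_numSelfIntersections hp) |>.exists.imp fun _ h => h.symm
  rw [HypSurface.range_geodesicFlow_eq] at hu
  exact absurd hle (not_le.mpr hu)
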